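/- Let $\Gamma$ be an Artin algebra, i.e. an algebra that is finitely generated as a module over a commutative Artinian ring, and let $n \ge 0$ be an integer. All modules are finitely generated left modules. For a $\Gamma$-module $M$ write $\operatorname{pd} M$ for its projective dimension (with $\operatorname{pd} 0 = -\infty$) and $\operatorname{soc} M$ for its socle, the sum of its simple submodules. Let $\operatorname{gldim}\Gamma$ be the supremum of $\operatorname{pd} M$ over all $\Gamma$-modules $M$, and let $\operatorname{domdim}\Gamma \in \{0,1,2,\dots,\infty\}$ be the supremum of all $m$ such that, in a minimal injective coresolution $0 \to \Gamma \to I_0 \to I_1 \to \cdots$ of the left regular module, $I_0, \dots, I_{m-1}$ are projective. The algebra $\Gamma$ is called an $n$-Auslander algebra if $\operatorname{gldim}\Gamma \le n+1 \le \operatorname{domdim}\Gamma$. Let $\operatorname{prinj}(\Gamma)$ be the class of $\Gamma$-modules that are both projective and injective. Suppose that $\operatorname{gldim}\Gamma = n+1$. Then $\Gamma$ is an $n$-Auslander algebra if and only if $$\operatorname{prinj}(\Gamma) = \{\, I \in \Gamma\text{-mod} \mid I \text{ is injective and } \operatorname{pd}(\operatorname{soc} I) \le n \,\}.$$ -/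

import Mathlib

noncomputable section

namespace ArtinAlg

open CategoryTheory

universe u

/-- The socle of a module: the sum of all its simple submodules. -/
def socle (Γ : Type u) [Ring Γ] (M : Type u) [AddCommGroup M] [Module Γ M] : Submodule Γ M :=
  sSup {S : Submodule Γ M | IsSimpleModule Γ S}

/-- A submodule is essential if it meets every nonzero submodule nontrivially. -/
def IsEssential {Γ : Type u} [Ring Γ] {M : Type u} [AddCommGroup M] [Module Γ M]
    (N : Submodule Γ M) : Prop :=
  ∀ K : Submodule Γ M, N ⊓ K = ⊥ → K = ⊥

/-- The global dimension of `Γ`: the supremum of the projective dimensions of the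
finitely generated left `Γ`-modules (the zero module has projective dimension `⊥`). -/
def globalDimension (Γ : Type u) [Ring Γ] : WithBot ℕ∞ :=
  ⨆ (M : ModuleCat.{u} Γ) (_ : Module.Finite Γ M), projectiveDimension M

/-- An injective coresolution `0 → M → I⁰ → I¹ → ⋯` is minimal if each kernel
`ker (Iⁱ → Iⁱ⁺¹)` is essential in `Iⁱ`. By exactness these kernels are the images of
`M → I⁰` and of `Iⁱ⁻¹ → Iⁱ`, so each `Iⁱ` is an injective envelope of the `i`-th cosyzygy. -/
def IsMinimalCoresolution {Γ : Type u} [Ring Γ] {M : ModuleCat.{u} Γ}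
    (R : InjectiveResolution M) : Prop :=
  ∀ i : ℕ, IsEssential (LinearMap.ker (R.cocomplex.d i (i + 1)).hom)

/-- The dominant dimension of `Γ`: the supremum of all `m` such that the first `m` terms
`I⁰, …, Iᵐ⁻¹` of a minimal injective coresolution of the left regular module are projective. -/
def dominantDimension (Γ : Type u) [Ring Γ] : ℕ∞ :=
  ⨆ (m : ℕ) (_ : ∃ R : InjectiveResolution (ModuleCat.of Γ Γ), IsMinimalCoresolution R ∧
    ∀ j < m, Module.Projective Γ (R.cocomplex.X j)), (m : ℕ∞)

/-- The condition `gldim Γ ≤ n + 1 ≤ domdim Γ` which defines the `n`-Auslander algebras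
among Artin algebras. -/
def IsAuslander (n : ℕ) (Γ : Type u) [Ring Γ] : Prop :=
  globalDimension Γ ≤ ((n + 1 : ℕ) : WithBot ℕ∞) ∧ ((n + 1 : ℕ) : ℕ∞) ≤ dominantDimension Γ

/-- The class of finitely generated projective-injective left `Γ`-modules. -/
def prinj (Γ : Type u) [Ring Γ] : ObjectProperty (ModuleCat.{u} Γ) :=
  fun I => Module.Finite Γ I ∧ Module.Projective Γ I ∧ Module.Injective Γ I

/-- The class of finitely generated injective left `Γ`-modules whose socle has projective
dimension at most `n`. -/
def injSoclePdLE (n : ℕ) (Γ : Type u) [Ring Γ] : ObjectProperty (ModuleCat.{u} Γ) :=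
  fun I => Module.Finite Γ I ∧ Module.Injective Γ I ∧
    projectiveDimension (ModuleCat.of Γ (socle Γ I)) ≤ (n : WithBot ℕ∞)

end ArtinAlg

end

namespace ArtinAlg

open CategoryTheory Abelian

universe u v

/-! ### Injective envelopes. -/

section Hull

variable {Γ : Type u} [Ring Γ]

/-! Let `gldim Γ ≤ n + 1`. Submodules of modules of projective dimension at most `n` again have
projective dimension at most `n`; this bounds the socle of a projective-injective.

Let the coresolution terms `I⁰, …, Iⁿ` be projective and `I` injective with `pd (soc I) ≤ n`. A
simple `S ≤ I` is a summand of the socle, so `pd S ≤ n`. A nonzero finitely generated module of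
projective dimension `i` has `Extⁱ(S, Γ) ≠ 0`, so some map `S → Iʲ` with `j ≤ n` is nonzero
(`exists_hom_ne_zero`). It extends to `I`. Finitely many such extensions embed the Artinian module
`I` in a projective, and the embedding splits.

Conversely, the socle of the envelope of `N` lies in `N`, so `pd N ≤ n` makes the envelope
projective by hypothesis. Inductively the `j`-th cosyzygy of `Γ` has projective dimension at most
`j`, which gives projective envelopes for all `j ≤ n`. The hypothesis concerns finitely generated
modules only, hence the need for `finite_of_isEssential`. -/

theorem exists_maximal_disjoint {M : Type v} [AddCommGroup M] [Module Γ M]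
    {N L : Submodule Γ M} (h : Disjoint N L) :
    ∃ K, L ≤ K ∧ Maximal (Disjoint N) K := by
  refine zorn_le_nonempty₀ {K | Disjoint N K} (fun c hc hchain y hy => ?_) L h
  exact ⟨sSup c, (hchain.directedOn.disjoint_sSup_right).2 fun K hK => hc hK,
    fun K hK => le_sSup hK⟩

/-- In a pair of submodules that are maximal disjoint from each other, inside an injective module,
the submodules are complements of each other. -/
theorem codisjoint_of_maximal_disjoint {I : Type u} [AddCommGroup I] [Module Γ I]
    (hI : Module.Injective Γ I) {E K : Submodule Γ I} (hE : Maximal (Disjoint K) E)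
    (hK : Maximal (Disjoint E) K) : Codisjoint E K := by
  have hinj : Function.Injective (K.mkQ ∘ₗ E.subtype) := by
    rw [← LinearMap.ker_eq_bot, LinearMap.ker_comp, Submodule.ker_mkQ]
    exact Submodule.disjoint_iff_comap_eq_bot.1 hE.prop.symm
  obtain ⟨φ, hφ⟩ := hI.out (K.mkQ ∘ₗ E.subtype) hinj E.subtype
  have hφE (e : E) : φ (K.mkQ e) = e := hφ e
  -- `φ ∘ₗ K.mkQ` fixes `E` pointwise, so its kernel and the preimage of `K` both meet `E`
  -- trivially; maximality of `K` puts them inside `K`. Its range then meets `K` trivially, so it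
  -- lies in `E` by maximality of `E`: the map is a projection onto `E` along `K`.
  have hker : LinearMap.ker (φ ∘ₗ K.mkQ) ⊔ K = K := by
    refine (sup_eq_right.2 (hK.le_of_ge ?_ ?_))
    · rw [Submodule.disjoint_def]
      intro x hx hx'
      have : φ (K.mkQ x) = 0 := hx'
      rw [hφE ⟨x, hx⟩] at this
      exact this
    · intro x hx
      simp [(Submodule.Quotient.mk_eq_zero K).2 hx]
  have hcom : Submodule.comap (φ ∘ₗ K.mkQ) K ≤ K := by
    refine hK.le_of_ge ?_ ?_
    · rw [Submodule.disjoint_def]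
      intro x hx hx'
      have : φ (K.mkQ x) ∈ K := hx'
      rw [hφE ⟨x, hx⟩] at this
      exact Submodule.disjoint_def.1 hE.prop x this hx
    · intro x hx
      simp [(Submodule.Quotient.mk_eq_zero K).2 hx]
  have hrange : LinearMap.range (φ ∘ₗ K.mkQ) ≤ E := by
    refine hE.le_of_ge ?_ ?_
    · rw [Submodule.disjoint_def]
      rintro _ hx ⟨y, rfl⟩
      have hy : y ∈ K := hcom hx
      simp [(Submodule.Quotient.mk_eq_zero K).2 hy]
    · intro x hx
      exact ⟨x, hφE ⟨x, hx⟩⟩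
  rw [codisjoint_iff, eq_top_iff]
  intro x _
  set e := φ (K.mkQ x) with he
  have heE : e ∈ E := hrange ⟨x, rfl⟩
  have hmem : x - e ∈ K := by
    refine hker.le (Submodule.mem_sup_left ?_)
    rw [LinearMap.mem_ker, map_sub, LinearMap.comp_apply, LinearMap.comp_apply, hφE ⟨e, heE⟩,
      ← he, sub_self]
  exact Submodule.mem_sup.2 ⟨e, heE, x - e, hmem, by abel⟩

theorem injective_of_leftInverse {E I : Type u} [AddCommGroup E] [Module Γ E] [AddCommGroup I]
    [Module Γ I] (hI : Module.Injective Γ I) (i : E →ₗ[Γ] I) (p : I →ₗ[Γ] E)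
    (h : ∀ x, p (i x) = x) : Module.Injective Γ E where
  out X Y _ _ _ _ f hf g := by
    obtain ⟨l, hl⟩ := hI.out f hf (i ∘ₗ g)
    exact ⟨p ∘ₗ l, fun x => by simp [hl, h]⟩

variable (Γ) in
/-- Every module has an injective envelope. -/
theorem exists_injectiveHull (M : Type u) [AddCommGroup M] [Module Γ M] :
    ∃ (E : ModuleCat.{u} Γ) (f : M →ₗ[Γ] E), Function.Injective f ∧ Module.Injective Γ E ∧
      IsEssential (LinearMap.range f) := by
  let I := Injective.under (ModuleCat.of Γ M)
  let g : M →ₗ[Γ] I := (Injective.ι (ModuleCat.of Γ M)).hom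
  have hg : Function.Injective g := (ModuleCat.mono_iff_injective _).1 inferInstance
  have hI : Module.Injective Γ I := by
    have : CategoryTheory.Injective (ModuleCat.of Γ I) :=
      inferInstanceAs (CategoryTheory.Injective (Injective.under (ModuleCat.of Γ M)))
    exact Module.injective_module_of_injective_object Γ I
  obtain ⟨K, -, hK⟩ := exists_maximal_disjoint (disjoint_bot_right (a := LinearMap.range g))
  obtain ⟨E, hNE, hE⟩ := exists_maximal_disjoint hK.prop.symm
  have hKE : Maximal (Disjoint E) K :=
    ⟨hE.prop.symm, fun L hL hKL => hK.2 (hL.mono_left hNE) hKL⟩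
  have hc : IsCompl E K := ⟨hE.prop.symm, codisjoint_of_maximal_disjoint hI hE hKE⟩
  have hgE (x : M) : g x ∈ E := hNE ⟨x, rfl⟩
  refine ⟨ModuleCat.of Γ E, g.codRestrict E hgE, ?_, ?_, ?_⟩
  · intro x y hxy
    exact hg (congrArg Subtype.val hxy)
  · exact injective_of_leftInverse hI E.subtype (Submodule.projectionOnto E K hc)
      (fun x => Submodule.projectionOnto_apply_left hc x)
  · intro L hL
    -- If `L ≤ E` misses the image of `M`, so does `K ⊔ L`; maximality of `K` forces `L ≤ K`, hence
    -- `L = ⊥`.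
    have hdis : Disjoint (LinearMap.range g) (K ⊔ L.map E.subtype) := by
      rw [Submodule.disjoint_def]
      rintro _ ⟨m, rfl⟩ hx
      obtain ⟨k, hk, _, ⟨l, hl, rfl⟩, hkl⟩ := Submodule.mem_sup.1 hx
      have hkE : k ∈ E := by
        rw [eq_sub_of_add_eq hkl]
        exact E.sub_mem (hgE m) l.2
      have hk0 : k = 0 := Submodule.disjoint_def.1 hE.prop k hk hkE
      rw [hk0, zero_add] at hkl
      have : l ∈ LinearMap.range (g.codRestrict E hgE) ⊓ L :=
        ⟨⟨m, Subtype.ext hkl.symm⟩, hl⟩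
      rw [hL] at this
      rw [← hkl, (Submodule.mem_bot Γ).1 this, map_zero]
    have hLK : L.map E.subtype ≤ K := le_sup_right.trans (hK.2 hdis le_sup_left)
    rw [eq_bot_iff]
    intro l hl
    have := Submodule.disjoint_def.1 hE.prop l (hLK ⟨l, hl, rfl⟩) l.2
    exact Subtype.ext this

end Hull

/-! ### Finiteness of essential extensions over an Artin algebra. -/

section Finite

variable {Γ : Type u} [Ring Γ]

/-- The elements of `M` annihilated by the two-sided ideal `J`. -/
def annihilatedBy (J : Ideal Γ) [J.IsTwoSided] (M : Type v) [AddCommGroup M] [Module Γ M] :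
    Submodule Γ M where
  carrier := {x | ∀ a ∈ J, a • x = 0}
  add_mem' hx hy a ha := by rw [smul_add, hx a ha, hy a ha, add_zero]
  zero_mem' a _ := smul_zero a
  smul_mem' c x hx a ha := by rw [smul_smul]; exact hx _ (J.mul_mem_right c ha)

/-- The annihilated part is a module over the semisimple ring `Γ ⧸ Ring.jacobson Γ`, so its
intersection with `N` has a complement there; that complement misses the essential `N` and vanishes.
-/
theorem annihilatedBy_jacobson_le [IsSemisimpleRing (Γ ⧸ Ring.jacobson Γ)] {M : Type u}
    [AddCommGroup M] [Module Γ M] {N : Submodule Γ M} (hN : IsEssential N) :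
    annihilatedBy (Ring.jacobson Γ) M ≤ N := by
  set T := annihilatedBy (Ring.jacobson Γ) M
  have htors : Module.IsTorsionBySet Γ T (Ring.jacobson Γ : Set Γ) := by
    rintro ⟨x, hx⟩ ⟨a, ha⟩
    exact Subtype.ext (hx a ha)
  have : IsSemisimpleModule Γ T := by
    let _ := htors.module
    exact (htors.semilinearMap.isSemisimpleModule_iff_of_bijective Function.bijective_id).2
      inferInstance
  obtain ⟨C, hC⟩ := exists_isCompl (N.comap T.subtype)
  have hbot : C.map T.subtype = ⊥ := by
    apply hN
    rw [eq_bot_iff]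
    rintro _ ⟨hxN, c, hc, rfl⟩
    have := Submodule.disjoint_def.1 hC.disjoint c hxN hc
    simp [this]
  have : C = ⊥ := 
    Submodule.map_injective_of_injective T.injective_subtype (hbot.trans (Submodule.map_bot _).symm)
  rw [this] at hC
  have htop : N.comap T.subtype = ⊤ := by simpa using hC.sup_eq_top
  exact Submodule.comap_subtype_eq_top.1 htop

/-- Sending `x` to `a ↦ a • x` maps the part killed by `J ^ (i + 1)` to `Hom_k(J ^ i, annihilatedBy
J M)`, a Noetherian `k`-module, with kernel the part killed by `J ^ i`. -/
theorem finite_annihilatedBy_pow (k : Type*) [CommRing k] [IsNoetherianRing k] [Algebra k Γ]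
    [Module.Finite k Γ] (J : Ideal Γ) [J.IsTwoSided] (M : Type v) [AddCommGroup M] [Module Γ M]
    [Module k M] [IsScalarTower k Γ M] (h : Module.Finite k (annihilatedBy J M)) (i : ℕ) :
    Module.Finite k (annihilatedBy (J ^ i) M) := by
  induction i with
  | zero =>
    have : annihilatedBy (J ^ 0) M = ⊥ := by
      rw [eq_bot_iff]
      intro x hx
      rw [Submodule.mem_bot, ← one_smul Γ x]
      exact hx 1 (by rw [Submodule.pow_zero, Ideal.one_eq_top]; trivial)
    rw [this]
    infer_instance
  | succ i ih =>
    have hnoeth : IsNoetherian k Γ := isNoetherian_of_isNoetherianRing_of_finite k Γ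
    let Ji : Submodule k Γ := (J ^ i).restrictScalars k
    have hmem (x : annihilatedBy (J ^ (i + 1)) M) (a : Ji) :
        (a : Γ) • (x : M) ∈ annihilatedBy J M := by
      intro b hb
      rw [smul_smul]
      refine x.2 _ ?_
      rw [Ideal.IsTwoSided.pow_succ]
      exact Ideal.mul_mem_mul hb a.2
    have : SMulCommClass k Γ M := IsScalarTower.to_smulCommClass
    let φ : annihilatedBy (J ^ (i + 1)) M →ₗ[k] (Ji →ₗ[k] annihilatedBy J M) :=
      LinearMap.mk₂ k (fun x a => ⟨(a : Γ) • (x : M), hmem x a⟩)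
        (fun x y a => Subtype.ext (smul_add _ _ _))
        (fun c x a => Subtype.ext (smul_comm _ _ _))
        (fun x a b => Subtype.ext (add_smul _ _ _))
        (fun c x a => Subtype.ext (smul_assoc _ _ _))
    have hJi : Module.Finite k Ji := Module.Finite.of_fg (hnoeth.noetherian Ji)
    have hnm : IsNoetherian k (annihilatedBy J M) :=
      isNoetherian_of_isNoetherianRing_of_finite k _
    have hni : IsNoetherian k (annihilatedBy (J ^ i) M) :=
      isNoetherian_of_isNoetherianRing_of_finite k _
    have hhom : IsNoetherian k (Ji →ₗ[k] annihilatedBy J M) := inferInstance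
    let ι : LinearMap.ker φ →ₗ[k] annihilatedBy (J ^ i) M :=
      { toFun := fun x => ⟨x.1.1, fun a ha =>
          congrArg Subtype.val (LinearMap.congr_fun x.2 (⟨a, ha⟩ : Ji))⟩
        map_add' := fun _ _ => rfl
        map_smul' := fun _ _ => rfl }
    have hι : Function.Injective ι := fun x y hxy =>
      Subtype.ext (Subtype.ext (congrArg (fun z : annihilatedBy (J ^ i) M => (z : M)) hxy))
    have hker : IsNoetherian k (LinearMap.ker φ) := isNoetherian_of_injective ι hι
    have hquot : IsNoetherian k (annihilatedBy (J ^ (i + 1)) M ⧸ LinearMap.ker φ) :=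
      isNoetherian_of_injective _ (LinearMap.ker_eq_bot.1 (Submodule.ker_liftQ_eq_bot' _ φ rfl))
    have : IsNoetherian k (annihilatedBy (J ^ (i + 1)) M) :=
      (isNoetherian_iff_submodule_quotient (LinearMap.ker φ)).2 ⟨hker, hquot⟩
    infer_instance

/-- Over an Artin algebra, essential extensions of finitely generated modules are finitely
generated. -/
theorem finite_of_isEssential (k : Type*) [CommRing k] [IsArtinianRing k] [Algebra k Γ]
    [Module.Finite k Γ] {M : Type u} [AddCommGroup M] [Module Γ M] (N : Submodule Γ M)
    [Module.Finite Γ N] (hN : IsEssential N) : Module.Finite Γ M := by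
  let _ : Module k M := Module.compHom M (algebraMap k Γ)
  have : IsScalarTower k Γ M := .of_algebraMap_smul fun _ _ => rfl
  have : IsArtinianRing Γ := .of_finite k Γ
  have hNk : Module.Finite k N := .trans Γ N
  have hnN : IsNoetherian k N := isNoetherian_of_isNoetherianRing_of_finite k N
  have hle := annihilatedBy_jacobson_le hN
  have h1 : Module.Finite k (annihilatedBy (Ring.jacobson Γ) M) := by
    have : IsNoetherian k (annihilatedBy (Ring.jacobson Γ) M) :=
      isNoetherian_of_injective ((Submodule.inclusion hle).restrictScalars k)
        (Submodule.inclusion_injective hle)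
    infer_instance
  obtain ⟨n, hn⟩ := IsSemiprimaryRing.isNilpotent (R := Γ)
  have hfin := finite_annihilatedBy_pow k (Ring.jacobson Γ) M h1 n
  have htop : annihilatedBy (Ring.jacobson Γ ^ n) M = ⊤ := by
    rw [eq_top_iff]
    intro x _ a ha
    rw [hn] at ha
    rw [(Submodule.mem_bot Γ).1 ha, zero_smul]
  rw [htop] at hfin
  have hf : Module.Finite Γ (⊤ : Submodule Γ M) := .of_restrictScalars_finite k Γ _
  exact Module.Finite.equiv Submodule.topEquiv

end Finite

/-! ### Projective dimension and `Ext` into `Γ`. -/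

section Homological

variable {Γ : Type u} [Ring Γ]

theorem ext_pi_eq_zero {X : ModuleCat.{u} Γ} {d : ℕ}
    (h : ∀ e : Ext X (ModuleCat.of Γ Γ) d, e = 0) (m : ℕ)
    (e : Ext X (ModuleCat.of Γ (Fin m → Γ)) d) : e = 0 := by
  have hid : 𝟙 (ModuleCat.of Γ (Fin m → Γ)) =
      ∑ i, (ModuleCat.ofHom (LinearMap.proj i : (Fin m → Γ) →ₗ[Γ] Γ) ≫
        ModuleCat.ofHom (LinearMap.single Γ (fun _ : Fin m => Γ) i)) := by
    ext x
    simp [ModuleCat.hom_sum]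
  rw [← e.comp_mk₀_id, hid, Ext.mk₀_sum, Ext.comp_sum]
  refine Finset.sum_eq_zero fun i _ => ?_
  rw [← Ext.mk₀_comp_mk₀, ← Ext.comp_assoc_of_second_deg_zero,
    h (e.comp _ _), Ext.zero_comp]

/-- Dimension shifting along a finitely generated free cover, whose kernel is again finitely
generated and so an admissible test module. -/
theorem hasProjectiveDimensionLT_of_ext_finite [IsNoetherianRing Γ] (X : ModuleCat.{u} Γ)
    [Module.Finite Γ X] (d : ℕ) [HasProjectiveDimensionLT X (d + 1)]
    (h : ∀ (Y : ModuleCat.{u} Γ) [Module.Finite Γ Y] (e : Ext X Y d), e = 0) :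
    HasProjectiveDimensionLT X d := by
  induction d generalizing X with
  | zero =>
    rw [hasProjectiveDimensionLT_zero_iff_isZero, Limits.IsZero.iff_id_eq_zero]
    apply Ext.homEquiv₀.symm.injective
    simpa only [Ext.homEquiv₀_symm_apply, Ext.mk₀_zero] using h X _
  | succ d ih =>
    obtain ⟨m, f, hf⟩ := Module.Finite.exists_fin' Γ X
    let S : ShortComplex (ModuleCat.{u} Γ) := f.shortComplexKer
    have hS : S.ShortExact := LinearMap.shortExact_shortComplexKer hf
    have hP : Projective S.X₂ :=
      (IsProjective.iff_projective (R := Γ) (Fin m → Γ)).1 inferInstance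
    have hK : Module.Finite Γ S.X₁ := Module.Finite.of_fg (IsNoetherian.noetherian _)
    -- `Ext¹` is separate: shifting would reach `Ext⁰` of the free module, which need not vanish.
    -- Instead the class of the cover is zero and `X` is a retract.
    obtain _ | d := d
    · have hs : hS.extClass = 0 := h S.X₁ _
      obtain ⟨x, hx⟩ := Ext.covariant_sequence_exact₃ X hS (Ext.mk₀ (𝟙 X)) (zero_add 1)
        (by rw [hs, Ext.comp_zero])
      obtain ⟨s, rfl⟩ := Ext.homEquiv₀.symm.surjective x
      have hsg : s ≫ S.g = 𝟙 X := by
        apply Ext.homEquiv₀.symm.injective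
        simpa using hx
      let r : Retract X S.X₂ := ⟨s, S.g, hsg⟩
      exact r.hasProjectiveDimensionLT 1
    · have h1 : HasProjectiveDimensionLT S.X₁ (d + 1 + 1) :=
        hS.hasProjectiveDimensionLT_X₁ (d + 2) inferInstance
          (inferInstanceAs (HasProjectiveDimensionLT X (d + 1 + 1 + 1)))
      have h2 : HasProjectiveDimensionLT S.X₁ (d + 1) := by
        refine ih S.X₁ fun Y _ e => ?_
        obtain ⟨e', rfl⟩ := Ext.contravariant_sequence_exact₁ hS Y e (n₁ := d + 1 + 1)
          (add_comm _ _) (h Y _)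
        rw [e'.eq_zero_of_projective, Ext.comp_zero]
      exact hS.hasProjectiveDimensionLT_X₃ (d + 1) h2 inferInstance

/-- If a finitely generated module `X` has projective dimension at most `d` and
`Extᵈ(X, Γ) = 0`, then its projective dimension is less than `d`. -/
theorem hasProjectiveDimensionLT_of_ext_self [IsNoetherianRing Γ] (X : ModuleCat.{u} Γ)
    [Module.Finite Γ X] (d : ℕ) [HasProjectiveDimensionLT X (d + 1)]
    (h : ∀ e : Ext X (ModuleCat.of Γ Γ) d, e = 0) :
    HasProjectiveDimensionLT X d := by
  refine hasProjectiveDimensionLT_of_ext_finite X d fun Y _ e => ?_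
  obtain ⟨m, f, hf⟩ := Module.Finite.exists_fin' Γ Y
  have hS : f.shortComplexKer.ShortExact := LinearMap.shortExact_shortComplexKer hf
  -- `Extᵈ⁺¹` vanishes on `X`, so `Extᵈ(X, -)` is right exact.
  obtain ⟨e', rfl⟩ := Ext.covariant_sequence_exact₃ X hS e rfl
    (Ext.eq_zero_of_hasProjectiveDimensionLT _ (d + 1) le_rfl)
  rw [ext_pi_eq_zero h m e', Ext.zero_comp]

theorem subsingleton_of_ext_self [IsNoetherianRing Γ] (X : ModuleCat.{u} Γ)
    [Module.Finite Γ X] (d : ℕ) (hX : HasProjectiveDimensionLT X d)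
    (h : ∀ i < d, ∀ e : Ext X (ModuleCat.of Γ Γ) i, e = 0) : Subsingleton X := by
  induction d with
  | zero =>
    exact ModuleCat.isZero_iff_subsingleton.1 (isZero_of_hasProjectiveDimensionLT_zero X)
  | succ d ih =>
    exact ih (hasProjectiveDimensionLT_of_ext_self X d (h d d.lt_succ_self))
      fun i hi => h i (hi.trans d.lt_succ_self)

/-- The short exact sequence `0 → ker dʲ → Iʲ → ker dʲ⁺¹ → 0` of an injective resolution. -/
noncomputable def cosyzygyShortComplex {M : ModuleCat.{u} Γ} (R : InjectiveResolution M) (j : ℕ) :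
    ShortComplex (ModuleCat.{u} Γ) where
  X₁ := ModuleCat.of Γ (LinearMap.ker (R.cocomplex.d j (j + 1)).hom)
  X₂ := R.cocomplex.X j
  X₃ := ModuleCat.of Γ (LinearMap.ker (R.cocomplex.d (j + 1) (j + 2)).hom)
  f := ModuleCat.ofHom (LinearMap.ker (R.cocomplex.d j (j + 1)).hom).subtype
  g := ModuleCat.ofHom ((R.cocomplex.d j (j + 1)).hom.codRestrict _ fun x => by
    have := R.cocomplex.d_comp_d j (j + 1) (j + 2)
    exact congr($this x))
  zero := by
    refine ModuleCat.hom_ext (LinearMap.ext fun x => ?_)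
    exact Subtype.ext x.2

theorem shortExact_cosyzygyShortComplex {M : ModuleCat.{u} Γ} (R : InjectiveResolution M)
    (j : ℕ) : (cosyzygyShortComplex R j).ShortExact where
  exact := by
    rw [ShortComplex.moduleCat_exact_iff]
    intro x hx
    exact ⟨⟨x, congrArg Subtype.val hx⟩, rfl⟩
  mono_f := (ModuleCat.mono_iff_injective _).2 (Submodule.injective_subtype _)
  epi_g := by
    rw [ModuleCat.epi_iff_surjective]
    rintro ⟨x, hx⟩
    obtain ⟨y, hy⟩ := (ShortComplex.moduleCat_exact_iff _).1 (R.exact_succ j) x hx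
    exact ⟨y, Subtype.ext hy⟩

/-- An injective resolution of `M` identifies `M` with the kernel of the first differential. -/
noncomputable def kerIso {M : ModuleCat.{u} Γ} (R : InjectiveResolution M) :
    ModuleCat.of Γ (LinearMap.ker (R.cocomplex.d 0 1).hom) ≅ M :=
  (ModuleCat.kernelIsLimit _).conePointUniqueUpToIso R.isLimitKernelFork

theorem ext_eq_zero_of_hom_eq_zero {M : ModuleCat.{u} Γ} (R : InjectiveResolution M)
    (X : ModuleCat.{u} Γ) (n : ℕ) (h : ∀ j ≤ n, ∀ f : X ⟶ R.cocomplex.X j, f = 0)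
    (i : ℕ) (hi : i ≤ n) (e : Ext X M i) : e = 0 := by
  -- `Extⁱ⁺¹` into the `j`-th cosyzygy comes from `Extⁱ` into the next one, so `i + j` is preserved
  -- until `Hom` is reached.
  have key (i : ℕ) : ∀ j, i + j ≤ n →
      ∀ e : Ext X (cosyzygyShortComplex R j).X₁ i, e = 0 := by
    induction i with
    | zero =>
      intro j hj e
      have hS := shortExact_cosyzygyShortComplex R j
      have := hS.mono_f
      obtain ⟨f, rfl⟩ := Ext.homEquiv₀.symm.surjective e
      have hf : f = 0 := by
        rw [← cancel_mono (cosyzygyShortComplex R j).f, Limits.zero_comp]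
        exact h j (by lia) _
      simp [hf]
    | succ i ih =>
      intro j hj e
      have hS := shortExact_cosyzygyShortComplex R j
      have : Injective (cosyzygyShortComplex R j).X₂ := R.injective j
      obtain ⟨e', rfl⟩ := Ext.covariant_sequence_exact₁ X hS e (Ext.eq_zero_of_injective _) rfl
      have he' : e' = 0 := ih (j + 1) (by lia) e'
      rw [he', Ext.zero_comp]
  rw [← e.comp_mk₀_id, ← (kerIso R).inv_hom_id, ← Ext.mk₀_comp_mk₀,
    ← Ext.comp_assoc_of_second_deg_zero]
  have he : e.comp (Ext.mk₀ (kerIso R).inv) (add_zero i) = 0 := key i 0 (by simpa using hi) _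
  rw [he, Ext.zero_comp]

theorem exists_hom_ne_zero [IsNoetherianRing Γ]
    (R : InjectiveResolution (ModuleCat.of Γ Γ)) (X : ModuleCat.{u} Γ) [Module.Finite Γ X]
    [Nontrivial X] (n : ℕ) (hX : HasProjectiveDimensionLE X n) :
    ∃ j ≤ n, ∃ f : X ⟶ R.cocomplex.X j, f ≠ 0 := by
  by_contra! h
  have := subsingleton_of_ext_self X (n + 1) hX fun i hi =>
    ext_eq_zero_of_hom_eq_zero R X n h i (by lia)
  exact false_of_nontrivial_of_subsingleton X

theorem hasProjectiveDimensionLE_of_globalDimension_le {n : ℕ}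
    (h : globalDimension Γ ≤ (n : WithBot ℕ∞)) (M : ModuleCat.{u} Γ) [Module.Finite Γ M] :
    HasProjectiveDimensionLE M n :=
  (projectiveDimension_le_iff M n).1 (le_trans (le_iSup₂_of_le M ‹_› le_rfl) h)

/-- If `gldim Γ ≤ n + 1`, then submodules of finitely generated modules of projective dimension at
most `n` have projective dimension at most `n`. -/
theorem hasProjectiveDimensionLE_of_submodule {n : ℕ}
    (h : globalDimension Γ ≤ ((n + 1 : ℕ) : WithBot ℕ∞)) {M : Type u} [AddCommGroup M]
    [Module Γ M] [Module.Finite Γ M] (hM : HasProjectiveDimensionLE (ModuleCat.of Γ M) n)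
    (N : Submodule Γ M) : HasProjectiveDimensionLE (ModuleCat.of Γ N) n := by
  let S : ShortComplex (ModuleCat.{u} Γ) :=
    { X₁ := ModuleCat.of Γ N, X₂ := ModuleCat.of Γ M, X₃ := ModuleCat.of Γ (M ⧸ N)
      f := ModuleCat.ofHom N.subtype, g := ModuleCat.ofHom N.mkQ
      zero := by ext; simp }
  have hS : S.ShortExact :=
    { exact := by
        rw [ShortComplex.moduleCat_exact_iff]
        intro x hx
        exact ⟨⟨x, (Submodule.Quotient.mk_eq_zero N).1 hx⟩, rfl⟩
      mono_f := (ModuleCat.mono_iff_injective _).2 N.injective_subtype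
      epi_g := (ModuleCat.epi_iff_surjective _).2 N.mkQ_surjective }
  exact hS.hasProjectiveDimensionLT_X₁ (n + 1) hM
    (hasProjectiveDimensionLE_of_globalDimension_le h (ModuleCat.of Γ (M ⧸ N)))

end Homological

/-! ### Injective resolutions from long exact sequences. -/

section Resolution

variable {Γ : Type u} [Ring Γ]

variable {M : ModuleCat.{u} Γ} (X : ℕ → ModuleCat.{u} Γ) (d : ∀ j, X j ⟶ X (j + 1)) (f : M ⟶ X 0)

theorem comp_eq_zero_of_range_eq_ker {A B C : ModuleCat.{u} Γ} {f : A ⟶ B} {g : B ⟶ C}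
    (h : LinearMap.range f.hom = LinearMap.ker g.hom) : f ≫ g = 0 := by
  refine ModuleCat.hom_ext (LinearMap.ext fun x => ?_)
  have hx : f.hom x ∈ LinearMap.ker g.hom := h ▸ ⟨x, rfl⟩
  exact hx

theorem exact_of_range_eq_ker {A B C : ModuleCat.{u} Γ} {f : A ⟶ B} {g : B ⟶ C}
    (h : LinearMap.range f.hom = LinearMap.ker g.hom) :
    (ShortComplex.mk f g (comp_eq_zero_of_range_eq_ker h)).Exact := by
  rw [ShortComplex.moduleCat_exact_iff]
  intro x hx
  have hx' : x ∈ LinearMap.range f.hom := h ▸ hx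
  exact hx'

/-- The cochain complex attached to a long exact sequence. -/
noncomputable def complexOfExact
    (hd : ∀ j, LinearMap.range (d j).hom = LinearMap.ker (d (j + 1)).hom) :
    CochainComplex (ModuleCat.{u} Γ) ℕ :=
  CochainComplex.of X d fun j => comp_eq_zero_of_range_eq_ker (hd j)

theorem complexOfExact_d
    (hd : ∀ j, LinearMap.range (d j).hom = LinearMap.ker (d (j + 1)).hom) (j : ℕ) :
    (complexOfExact X d hd).d j (j + 1) = d j :=
  CochainComplex.of_d _ _ _

theorem complexOfExact_exactAt_succ
    (hd : ∀ j, LinearMap.range (d j).hom = LinearMap.ker (d (j + 1)).hom) (j : ℕ) :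
    (complexOfExact X d hd).ExactAt (j + 1) := by
  rw [HomologicalComplex.exactAt_iff' _ j (j + 1) (j + 1 + 1) (by simp) (by simp)]
  simp only [HomologicalComplex.sc', HomologicalComplex.shortComplexFunctor', complexOfExact_d]
  exact exact_of_range_eq_ker (hd j)

theorem comp_complexOfExact_d
    (hd : ∀ j, LinearMap.range (d j).hom = LinearMap.ker (d (j + 1)).hom)
    (hf : LinearMap.range f.hom = LinearMap.ker (d 0).hom) :
    (show M ⟶ (complexOfExact X d hd).X 0 from f) ≫ (complexOfExact X d hd).d 0 1 = 0 :=
  (congrArg (fun g => f ≫ g) (complexOfExact_d X d hd 0)).trans (comp_eq_zero_of_range_eq_ker hf)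

/-- A long exact sequence `0 → M → X⁰ → X¹ → ⋯` with injective `Xʲ`, as an injective resolution. -/
noncomputable def resolutionOfExact
    (hX : ∀ j, Injective (X j)) (hmono : Mono f)
    (hd : ∀ j, LinearMap.range (d j).hom = LinearMap.ker (d (j + 1)).hom)
    (hf : LinearMap.range f.hom = LinearMap.ker (d 0).hom) : InjectiveResolution M where
  cocomplex := complexOfExact X d hd
  injective := hX
  ι := (CochainComplex.fromSingle₀Equiv _ _).symm ⟨f, comp_complexOfExact_d X d f hd hf⟩
  quasiIso := ⟨fun n => by
    cases n
    · rw [CochainComplex.quasiIsoAt₀_iff, ShortComplex.quasiIso_iff_of_zeros]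
      · refine (ShortComplex.exact_and_mono_f_iff_of_iso ?_).2
          ⟨exact_of_range_eq_ker hf, hmono⟩
        exact ShortComplex.isoMk (Iso.refl _) (Iso.refl _) (Iso.refl _)
          ((Category.id_comp f).trans
            ((CochainComplex.fromSingle₀Equiv_symm_apply_f_zero (C := complexOfExact X d hd) f
              (comp_complexOfExact_d X d f hd hf)).symm.trans (Category.comp_id _).symm))
          ((Category.id_comp (d 0)).trans
            ((complexOfExact_d X d hd 0).symm.trans (Category.comp_id _).symm))
      all_goals rfl
    · rw [quasiIsoAt_iff_exactAt]
      · apply complexOfExact_exactAt_succ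
      · apply CochainComplex.exactAt_succ_single_obj⟩

theorem isMinimalCoresolution_resolutionOfExact
    (hX : ∀ j, Injective (X j)) (hmono : Mono f)
    (hd : ∀ j, LinearMap.range (d j).hom = LinearMap.ker (d (j + 1)).hom)
    (hf : LinearMap.range f.hom = LinearMap.ker (d 0).hom)
    (hess : ∀ j, IsEssential (LinearMap.ker (d j).hom)) :
    IsMinimalCoresolution (resolutionOfExact X d f hX hmono hd hf) := by
  intro j
  have h := complexOfExact_d X d hd j
  change IsEssential (LinearMap.ker ((complexOfExact X d hd).d j (j + 1)).hom)
  exact Eq.subst (motive := fun g : X j ⟶ X (j + 1) => IsEssential (LinearMap.ker g.hom))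
    h.symm (hess j)

end Resolution

/-! ### The minimal injective coresolution. -/

section MinimalCoresolution

variable {Γ : Type u} [Ring Γ]

/-- An injective envelope of `M`. -/
noncomputable def injectiveHull (M : ModuleCat.{u} Γ) : ModuleCat.{u} Γ :=
  (exists_injectiveHull Γ M).choose

/-- The inclusion of `M` into its injective envelope. -/
noncomputable def toInjectiveHull (M : ModuleCat.{u} Γ) : M →ₗ[Γ] injectiveHull M :=
  (exists_injectiveHull Γ M).choose_spec.choose

theorem toInjectiveHull_injective (M : ModuleCat.{u} Γ) :
    Function.Injective (toInjectiveHull M) :=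
  (exists_injectiveHull Γ M).choose_spec.choose_spec.1

theorem injective_injectiveHull (M : ModuleCat.{u} Γ) : Module.Injective Γ (injectiveHull M) :=
  (exists_injectiveHull Γ M).choose_spec.choose_spec.2.1

theorem isEssential_range_toInjectiveHull (M : ModuleCat.{u} Γ) :
    IsEssential (LinearMap.range (toInjectiveHull M)) :=
  (exists_injectiveHull Γ M).choose_spec.choose_spec.2.2

/-- The iterated cosyzygies of `M`. -/
noncomputable def cosyzygy (M : ModuleCat.{u} Γ) : ℕ → ModuleCat.{u} Γ
  | 0 => M
  | j + 1 => ModuleCat.of Γ (injectiveHull (cosyzygy M j) ⧸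
      LinearMap.range (toInjectiveHull (cosyzygy M j)))

/-- The projection of the injective envelope of a cosyzygy onto the next cosyzygy. -/
noncomputable def toCosyzygy (M : ModuleCat.{u} Γ) (j : ℕ) :
    injectiveHull (cosyzygy M j) →ₗ[Γ] cosyzygy M (j + 1) :=
  (LinearMap.range (toInjectiveHull (cosyzygy M j))).mkQ

theorem toCosyzygy_surjective (M : ModuleCat.{u} Γ) (j : ℕ) :
    Function.Surjective (toCosyzygy M j) :=
  Submodule.mkQ_surjective _

theorem ker_toCosyzygy (M : ModuleCat.{u} Γ) (j : ℕ) :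
    LinearMap.ker (toCosyzygy M j) = LinearMap.range (toInjectiveHull (cosyzygy M j)) :=
  Submodule.ker_mkQ _

/-- The differential of the minimal injective coresolution. -/
noncomputable def minimalDifferential (M : ModuleCat.{u} Γ) (j : ℕ) :
    injectiveHull (cosyzygy M j) ⟶ injectiveHull (cosyzygy M (j + 1)) :=
  ModuleCat.ofHom (X := injectiveHull (cosyzygy M j)) (Y := injectiveHull (cosyzygy M (j + 1)))
    (toInjectiveHull (cosyzygy M (j + 1)) ∘ₗ toCosyzygy M j)

theorem ker_minimalDifferential (M : ModuleCat.{u} Γ) (j : ℕ) :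
    LinearMap.ker (minimalDifferential M j).hom =
      LinearMap.range (toInjectiveHull (cosyzygy M j)) :=
  (LinearMap.ker_comp_of_ker_eq_bot _
    (LinearMap.ker_eq_bot.2 (toInjectiveHull_injective _))).trans (ker_toCosyzygy M j)

theorem range_minimalDifferential (M : ModuleCat.{u} Γ) (j : ℕ) :
    LinearMap.range (minimalDifferential M j).hom =
      LinearMap.range (toInjectiveHull (cosyzygy M (j + 1))) :=
  LinearMap.range_comp_of_range_eq_top _ (LinearMap.range_eq_top.2 (toCosyzygy_surjective M j))

/-- The minimal injective coresolution of a module. -/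
noncomputable def minimalCoresolution (M : ModuleCat.{u} Γ) : InjectiveResolution M :=
  resolutionOfExact (fun j => injectiveHull (cosyzygy M j)) (minimalDifferential M)
    (ModuleCat.ofHom (X := M) (Y := injectiveHull M) (toInjectiveHull M))
    (fun j => by
      have := injective_injectiveHull (cosyzygy M j)
      exact Module.injective_object_of_injective_module Γ (injectiveHull (cosyzygy M j)))
    ((ModuleCat.mono_iff_injective _).2 (toInjectiveHull_injective M))
    (fun j => (range_minimalDifferential M j).trans (ker_minimalDifferential M (j + 1)).symm)
    (ker_minimalDifferential M 0).symm

theorem isMinimalCoresolution_minimalCoresolution (M : ModuleCat.{u} Γ) :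
    IsMinimalCoresolution (minimalCoresolution M) :=
  isMinimalCoresolution_resolutionOfExact _ _ _ _ _ _ _ fun j => by
    rw [ker_minimalDifferential]
    exact isEssential_range_toInjectiveHull _

end MinimalCoresolution

/-! ### Socles, projective-injectives and dominant dimension. -/

section Main

variable {Γ : Type u} [Ring Γ]

theorem le_socle {M : Type u} [AddCommGroup M] [Module Γ M] {S : Submodule Γ M}
    (hS : IsSimpleModule Γ S) : S ≤ socle Γ M :=
  le_sSup hS

theorem socle_le_of_isEssential {M : Type u} [AddCommGroup M] [Module Γ M] {N : Submodule Γ M}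
    (hN : IsEssential N) : socle Γ M ≤ N := by
  refine sSup_le fun S (hS : IsSimpleModule Γ S) => ?_
  have hatom := isSimpleModule_iff_isAtom.1 hS
  refine hatom.not_disjoint_iff_le.1 fun hdis => hatom.1 (hN S ?_)
  exact hdis.symm.eq_bot

theorem isSemisimpleModule_socle (M : Type u) [AddCommGroup M] [Module Γ M] :
    IsSemisimpleModule Γ (socle Γ M) := by
  have : socle Γ M = ⨆ S ∈ {S : Submodule Γ M | IsSimpleModule Γ S}, S := sSup_eq_iSup
  rw [this]
  exact isSemisimpleModule_biSup_of_isSemisimpleModule_submodule fun S hS => by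
    have : IsSimpleModule Γ S := hS
    infer_instance

theorem hasProjectiveDimensionLT_of_le {M : Type u} [AddCommGroup M] [Module Γ M]
    {S N : Submodule Γ M} [IsSemisimpleModule Γ N] (hSN : S ≤ N) (n : ℕ)
    (h : HasProjectiveDimensionLT (ModuleCat.of Γ N) n) :
    HasProjectiveDimensionLT (ModuleCat.of Γ S) n := by
  obtain ⟨p, hp⟩ := IsSemisimpleModule.extension_property (Submodule.inclusion hSN)
    (Submodule.inclusion_injective hSN) LinearMap.id
  let r : Retract (ModuleCat.of Γ S) (ModuleCat.of Γ N) :=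
    ⟨ModuleCat.ofHom (Submodule.inclusion hSN), ModuleCat.ofHom p, ModuleCat.hom_ext hp⟩
  exact r.hasProjectiveDimensionLT n

/-- If every simple submodule of the injective Artinian module `I` is detected by a map from `I`
to a projective module, then `I` is projective. -/
theorem projective_of_forall_simple {I : Type u} [AddCommGroup I] [Module Γ I] [IsArtinian Γ I]
    (hI : Module.Injective Γ I)
    (h : ∀ S : Submodule Γ I, IsSimpleModule Γ S → ∃ (P : ModuleCat.{u} Γ) (g : I →ₗ[Γ] P),
      Module.Projective Γ P ∧ ¬ S ≤ LinearMap.ker g) : Module.Projective Γ I := by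
  let A : Set (Submodule Γ I) := {K | ∃ (P : ModuleCat.{u} Γ) (g : I →ₗ[Γ] P),
    Module.Projective Γ P ∧ LinearMap.ker g = K}
  have hA : A.Nonempty :=
    ⟨⊤, ModuleCat.of Γ PUnit.{u + 1}, 0, inferInstanceAs (Module.Projective Γ PUnit.{u + 1}),
      LinearMap.ker_zero⟩
  -- A nonzero minimal kernel would contain a simple `S`; pairing `φ` with a map detecting `S`
  -- shrinks it.
  obtain ⟨K, ⟨P, φ, hP, rfl⟩, hmin⟩ := IsArtinian.set_has_minimal A hA
  have hbot : LinearMap.ker φ = ⊥ := by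
    by_contra hne
    obtain ⟨S, hS, hSK⟩ := (eq_bot_or_exists_atom_le (LinearMap.ker φ)).resolve_left hne
    obtain ⟨Q, g, hQ, hg⟩ := h S (isSimpleModule_iff_isAtom.2 hS)
    have hker : LinearMap.ker (φ.prod g) = LinearMap.ker φ ⊓ LinearMap.ker g :=
      LinearMap.ker_prod φ g
    refine hmin (LinearMap.ker (φ.prod g)) ⟨ModuleCat.of Γ (P × Q), φ.prod g,
      inferInstanceAs (Module.Projective Γ (P × Q)), rfl⟩ ?_
    rw [hker]
    exact inf_lt_left.2 fun hle => hg (hSK.trans hle)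
  obtain ⟨l, hl⟩ := hI.out φ (LinearMap.ker_eq_bot.1 hbot) LinearMap.id
  exact Module.Projective.of_split φ l (LinearMap.ext hl)

theorem projective_of_projectiveDimension_socle_le [IsArtinianRing Γ] {n : ℕ}
    (R : InjectiveResolution (ModuleCat.of Γ Γ))
    (hR : ∀ j ≤ n, Module.Projective Γ (R.cocomplex.X j))
    {I : Type u} [AddCommGroup I] [Module Γ I] [Module.Finite Γ I] (hI : Module.Injective Γ I)
    (h : HasProjectiveDimensionLE (ModuleCat.of Γ (socle Γ I)) n) : Module.Projective Γ I := by
  refine projective_of_forall_simple hI fun S hS => ?_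
  have := isSemisimpleModule_socle (Γ := Γ) I
  have hSpd : HasProjectiveDimensionLE (ModuleCat.of Γ S) n :=
    hasProjectiveDimensionLT_of_le (le_socle hS) (n + 1) h
  have hfin : Module.Finite Γ (ModuleCat.of Γ S) := inferInstanceAs (Module.Finite Γ S)
  have hnt : Nontrivial (ModuleCat.of Γ S) := IsSimpleModule.nontrivial Γ S
  obtain ⟨j, hj, f, hf⟩ := exists_hom_ne_zero R (ModuleCat.of Γ S) n hSpd
  have hinj : Module.Injective Γ (R.cocomplex.X j) := by
    have : Injective (ModuleCat.of Γ (R.cocomplex.X j)) := R.injective j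
    exact Module.injective_module_of_injective_object Γ (R.cocomplex.X j)
  obtain ⟨g, hg⟩ := hinj.out S.subtype S.injective_subtype f.hom
  refine ⟨R.cocomplex.X j, g, hR j hj, fun hle => hf ?_⟩
  refine ModuleCat.hom_ext (LinearMap.ext fun x => ?_)
  exact (hg x).symm.trans (hle x.2)

theorem prinj_le_injSoclePdLE {n : ℕ}
    (hgl : globalDimension Γ ≤ ((n + 1 : ℕ) : WithBot ℕ∞)) : prinj Γ ≤ injSoclePdLE n Γ := by
  rintro I ⟨hfin, hproj, hinj⟩
  refine ⟨hfin, hinj, (projectiveDimension_le_iff _ _).2 ?_⟩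
  have : Projective (ModuleCat.of Γ I) := (IsProjective.iff_projective (R := Γ) I).1 hproj
  exact hasProjectiveDimensionLE_of_submodule hgl
    (hasProjectiveDimensionLT_of_ge _ 1 (n + 1) (by lia)) _

/-- The supremum runs over natural numbers, so if no resolution reached `n + 1` it would be at most
`n`. -/
theorem exists_resolution_of_le_dominantDimension {n : ℕ}
    (h : ((n + 1 : ℕ) : ℕ∞) ≤ dominantDimension Γ) :
    ∃ R : InjectiveResolution (ModuleCat.of Γ Γ),
      ∀ j ≤ n, Module.Projective Γ (R.cocomplex.X j) := by
  by_contra! hR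
  have hle : dominantDimension Γ ≤ (n : ℕ∞) := by
    refine iSup₂_le fun m ⟨R, _, hm⟩ => ?_
    obtain ⟨j, hj, hnp⟩ := hR R
    by_contra! hlt
    exact hnp (hm j (hj.trans_lt (by exact_mod_cast hlt)))
  have := h.trans hle
  norm_cast at this
  lia

theorem projectiveDimension_socle_injectiveHull_le {n : ℕ}
    (hgl : globalDimension Γ ≤ ((n + 1 : ℕ) : WithBot ℕ∞)) (M : ModuleCat.{u} Γ)
    [Module.Finite Γ M] (hM : HasProjectiveDimensionLE M n) :
    HasProjectiveDimensionLE (ModuleCat.of Γ (socle Γ (injectiveHull M))) n := by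
  let e : M ≃ₗ[Γ] LinearMap.range (toInjectiveHull M) :=
    LinearEquiv.ofInjective _ (toInjectiveHull_injective M)
  have hfin : Module.Finite Γ (LinearMap.range (toInjectiveHull M)) := .equiv e
  have hr : HasProjectiveDimensionLE
      (ModuleCat.of Γ (LinearMap.range (toInjectiveHull M))) n :=
    hasProjectiveDimensionLT_of_iso e.toModuleIso (n + 1)
  have hs := hasProjectiveDimensionLE_of_submodule hgl hr
    ((socle Γ (injectiveHull M)).comap (LinearMap.range (toInjectiveHull M)).subtype)
  exact hasProjectiveDimensionLT_of_iso (Submodule.comapSubtypeEquivOfLe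
    (socle_le_of_isEssential (isEssential_range_toInjectiveHull M))).toModuleIso (n + 1)

theorem hasProjectiveDimensionLE_cosyzygy_succ (M : ModuleCat.{u} Γ) (j d : ℕ)
    (h : HasProjectiveDimensionLE (cosyzygy M j) d)
    (hP : Module.Projective Γ (injectiveHull (cosyzygy M j))) :
    HasProjectiveDimensionLE (cosyzygy M (j + 1)) (d + 1) := by
  let S : ShortComplex (ModuleCat.{u} Γ) :=
    { X₁ := cosyzygy M j, X₂ := injectiveHull (cosyzygy M j), X₃ := cosyzygy M (j + 1)
      f := ModuleCat.ofHom (Y := injectiveHull (cosyzygy M j)) (toInjectiveHull (cosyzygy M j))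
      g := ModuleCat.ofHom (X := injectiveHull (cosyzygy M j)) (toCosyzygy M j)
      zero := comp_eq_zero_of_range_eq_ker (ker_toCosyzygy M j).symm }
  have hS : S.ShortExact :=
    { exact := exact_of_range_eq_ker (ker_toCosyzygy M j).symm
      mono_f := (ModuleCat.mono_iff_injective _).2 (toInjectiveHull_injective _)
      epi_g := (ModuleCat.epi_iff_surjective _).2 (toCosyzygy_surjective M j) }
  have : Projective S.X₂ :=
    (IsProjective.iff_projective (R := Γ) (injectiveHull (cosyzygy M j))).1 hP
  exact hS.hasProjectiveDimensionLT_X₃ (d + 1) h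
    (hasProjectiveDimensionLT_of_ge _ 1 _ (by lia))

/-- If the injective modules with socle of projective dimension at most `n` are projective, then
the first terms of the minimal injective coresolution of a projective module are projective. -/
theorem projective_injectiveHull_cosyzygy (k : Type v) [CommRing k] [IsArtinianRing k]
    [Algebra k Γ] [Module.Finite k Γ] {n : ℕ}
    (hgl : globalDimension Γ ≤ ((n + 1 : ℕ) : WithBot ℕ∞)) (h : injSoclePdLE n Γ ≤ prinj Γ)
    (M : ModuleCat.{u} Γ) [Module.Finite Γ M] [Projective M] (j : ℕ) (hj : j ≤ n) :
    Module.Projective Γ (injectiveHull (cosyzygy M j)) := by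
  have step (N : ModuleCat.{u} Γ) (hfin : Module.Finite Γ N)
      (hpd : HasProjectiveDimensionLE N n) : prinj Γ (injectiveHull N) := by
    have : Module.Finite Γ (LinearMap.range (toInjectiveHull N)) := inferInstance
    exact h _ ⟨finite_of_isEssential k _ (isEssential_range_toInjectiveHull N),
      injective_injectiveHull N, (projectiveDimension_le_iff _ _).2
        (projectiveDimension_socle_injectiveHull_le hgl N hpd)⟩
  -- Projectivity of each envelope bounds the next cosyzygy, and that bound, while at most `n`,
  -- makes the next envelope projective.
  have key (j : ℕ) : j ≤ n →
      Module.Finite Γ (cosyzygy M j) ∧ HasProjectiveDimensionLE (cosyzygy M j) j := by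
    induction j with
    | zero => exact fun _ => ⟨‹_›, inferInstanceAs (HasProjectiveDimensionLT M 1)⟩
    | succ j ih =>
      intro hj
      obtain ⟨hfin, hpd⟩ := ih (by lia)
      obtain ⟨hf, hp, -⟩ := step _ hfin (hasProjectiveDimensionLT_of_ge _ (j + 1) _ (by lia))
      exact ⟨.of_surjective _ (toCosyzygy_surjective M j),
        hasProjectiveDimensionLE_cosyzygy_succ M j j hpd hp⟩
  obtain ⟨hfin, hpd⟩ := key j hj
  exact (step _ hfin (hasProjectiveDimensionLT_of_ge _ (j + 1) _ (by lia))).2.1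

theorem le_dominantDimension_of_injSoclePdLE_le (k : Type v) [CommRing k] [IsArtinianRing k]
    [Algebra k Γ] [Module.Finite k Γ] {n : ℕ}
    (hgl : globalDimension Γ ≤ ((n + 1 : ℕ) : WithBot ℕ∞)) (h : injSoclePdLE n Γ ≤ prinj Γ) :
    ((n + 1 : ℕ) : ℕ∞) ≤ dominantDimension Γ := by
  refine le_iSup₂_of_le (n + 1) ⟨minimalCoresolution (ModuleCat.of Γ Γ),
    isMinimalCoresolution_minimalCoresolution _, fun j hj => ?_⟩ le_rfl
  have hfin : Module.Finite Γ (ModuleCat.of Γ Γ) := inferInstanceAs (Module.Finite Γ Γ)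
  have hproj : Projective (ModuleCat.of Γ Γ) :=
    (IsProjective.iff_projective (R := Γ) Γ).1 inferInstance
  exact projective_injectiveHull_cosyzygy k hgl h (ModuleCat.of Γ Γ) j (by lia)

end Main

end ArtinAlg

theorem corollary4p2 (k : Type*) [CommRing k] [IsArtinianRing k]
    (Γ : Type*) [Ring Γ] [Algebra k Γ] [Module.Finite k Γ] (n : ℕ)
    (hgl : ArtinAlg.globalDimension Γ = ((n + 1 : ℕ) : WithBot ℕ∞)) :
    ArtinAlg.IsAuslander n Γ ↔ ArtinAlg.prinj Γ = ArtinAlg.injSoclePdLE n Γ := by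
  have : IsArtinianRing Γ := .of_finite k Γ
  constructor
  · rintro ⟨-, hdom⟩
    obtain ⟨R, hR⟩ := ArtinAlg.exists_resolution_of_le_dominantDimension hdom
    refine le_antisymm (ArtinAlg.prinj_le_injSoclePdLE hgl.le) ?_
    rintro I ⟨hfin, hinj, hpd⟩
    exact ⟨hfin, ArtinAlg.projective_of_projectiveDimension_socle_le R hR hinj
      ((CategoryTheory.projectiveDimension_le_iff _ _).1 hpd), hinj⟩
  · intro h
    exact ⟨hgl.le, ArtinAlg.le_dominantDimension_of_injSoclePdLE_le k hgl.le h.ge⟩
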